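/- Let $K$ be a $C_1$ field (every form over $K$ of degree $d\ge 1$ in more than $d$ variables has a nontrivial zero in $K$) that admits normic forms of every degree $d\ge 1$ (forms of degree $d$ in $d$ variables with no nontrivial zero in $K$). Let $X_\Sigma$ be a simplicial projective toric variety over $K$, split over $K$, defined by a fan $\Sigma\subset N_{\mathbb R}\simeq\mathbb R^n$, such that the order of the torsion subgroup of $\operatorname{Cl}(X_\Sigma)$ is prime to the characteristic of $K$ (no condition in characteristic $0$). Let $\Sigma(1)$ be the set of one-dimensional cones, $u_\rho$ the minimal generator of $\rho\in\Sigma(1)$ and $D_\rho$ the corresponding toric divisor. Let $S=K[x_\rho,\ \rho\in\Sigma(1)]$ be the Cox ring, graded by $\operatorname{Cl}(X_\Sigma)$ with $\deg x_\rho=[D_\rho]$, let $Z(\Sigma)\subset\mathbb A^{\Sigma(1)}$ be the common zero set of the monomials $\prod_{\rho\not\subset\sigma}x_\rho$, $\sigma\in\Sigma$, and let $\pi:\mathbb A^{\Sigma(1)}\setminus Z(\Sigma)\to X_\Sigma$ be the quotient map. Let $D$ be a nef Cartier divisor on $X_\Sigma$ defined by a nonzero homogeneous polynomial $f\in S_{[D]}$: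 $$D=\mathbf V(f)=\{\pi(x)\in X_\Sigma \mid f(x)=0\}.$$ Choose a torus-invariant divisor $\sum_\rho a_\rho D_\rho$ linearly equivalent to $D$, and let $\Sigma_{[D]}$ be the (possibly degenerate) normal fan in $N_{\mathbb R}$ of the polytope $\{m\in M_{\mathbb R}\mid \langle m,u_\rho\rangle\ge -a_\rho \text{ for all }\rho\in\Sigma(1)\}$; it depends only on the class $[D]$. The following conditions are equivalent: 1. there exists a root $\alpha\in K^{\Sigma(1)}$ of $f$ such that the set $\{\rho\in\Sigma(1)\mid\alpha_\rho=0\}$ is contained in a single cone of $\Sigma_{[D]}$ (that is, all these $\rho$ lie in one cone of $\Sigma_{[D]}$); 2. there exists a root $\alpha\in K^{\Sigma(1)}$ of $f$ such that the set $\{\rho\in\Sigma(1)\mid\alpha_\rho=0\}$ is contained in a single cone of $\Sigma$. If these conditions are satisfied, then $D$ has a rational point over $K$. -/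

import Mathlib

open scoped Matrix

noncomputable section

/-! ### Hypotheses on the ground field -/

/-- `K` is a `C₁` field: every form of degree `d ≥ 1` in more than `d` variables has a nontrivial
zero, i.e. every degree `d` hypersurface of `ℙ^N` with `d ≤ N` has a `K`-point. -/
def IsC1Field (K : Type*) [Field K] : Prop :=
  ∀ (N d : ℕ) (g : MvPolynomial (Fin N) K), 1 ≤ d → d < N → g.IsHomogeneous d →
    ∃ x : Fin N → K, x ≠ 0 ∧ MvPolynomial.eval x g = 0

/-- `K` admits normic forms of every degree `d ≥ 1`: forms of degree `d` in `d` variables whose only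
zero is the trivial one. -/
def AdmitsNormicForms (K : Type*) [Field K] : Prop :=
  ∀ d : ℕ, 1 ≤ d → ∃ g : MvPolynomial (Fin d) K, g.IsHomogeneous d ∧
    ∀ x : Fin d → K, MvPolynomial.eval x g = 0 → x = 0

/-! ### Polytopes and their (possibly degenerate) normal fans

Both lattices `M` (characters) and `N` (one-parameter subgroups) are `ℤⁿ`, paired by the dot
product; `M_ℝ` and `N_ℝ` are `ℝⁿ`. -/

/-- The embedding of the lattice `ℤⁿ` in `ℝⁿ`. -/
def latticeVec {n : ℕ} (v : Fin n → ℤ) : Fin n → ℝ := fun i => (v i : ℝ)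

/-- The face of `P ⊆ M_ℝ` on which the linear form `w ∈ N_ℝ` is minimal on `P`. -/
def polytopeFace {n : ℕ} (P : Set (Fin n → ℝ)) (w : Fin n → ℝ) : Set (Fin n → ℝ) :=
  {q | q ∈ P ∧ ∀ p ∈ P, q ⬝ᵥ w ≤ p ⬝ᵥ w}

/-- The cone of inner normals dual to a face `Q` of `P`: the `u ∈ N_ℝ` that, as linear forms on `P`,
are minimal at every point of `Q`. For a vertex `Q = {v}` it is the dual of the cone generated by
`P - v`. -/
def innerNormalCone {n : ℕ} (P Q : Set (Fin n → ℝ)) : Set (Fin n → ℝ) :=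
  {u | ∀ q ∈ Q, ∀ p ∈ P, q ⬝ᵥ u ≤ p ⬝ᵥ u}

/-- The normal fan of a polytope `P ⊆ M_ℝ`, as a set of cones in `N_ℝ`: the inner normal cones of
the nonempty faces of `P`. It is degenerate (its cones contain a common line) when `P` is not full
dimensional. -/
def normalFan {n : ℕ} (P : Set (Fin n → ℝ)) : Set (Set (Fin n → ℝ)) :=
  {σ | ∃ w, (polytopeFace P w).Nonempty ∧ σ = innerNormalCone P (polytopeFace P w)}

/-! ### Simplicial fans -/

/-- A (rational, strongly convex) simplicial fan in `N_ℝ = ℝⁿ` whose one-dimensional cones are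
indexed by `ι`. A cone `σ` is recorded by the set `σ(1) ⊆ ι` of its one-dimensional faces: it is
generated by the linearly independent vectors `u ρ`, `ρ ∈ σ(1)`. -/
structure SimplicialFan (n : ℕ) (ι : Type*) where
  /-- the minimal generators of the one-dimensional cones -/
  u : ι → Fin n → ℤ
  /-- the cones of the fan, given by their sets of rays -/
  cones : Set (Set ι)
  /-- `u ρ` is the minimal generator of `N ∩ ρ` -/
  u_primitive : ∀ ρ (k : ℤ) (v : Fin n → ℤ), u ρ = k • v → IsUnit k
  zero_mem : ∅ ∈ cones
  ray_mem : ∀ ρ, {ρ} ∈ cones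
  /-- a face of a cone of the fan is a cone of the fan -/
  face_mem : ∀ s ∈ cones, ∀ t, t ⊆ s → t ∈ cones
  /-- the cones are simplicial -/
  linearIndependent : ∀ s ∈ cones, LinearIndependent ℝ (fun ρ : s => latticeVec (u ρ))
  /-- two cones of the fan intersect along their common face -/
  inter_eq : ∀ s ∈ cones, ∀ t ∈ cones,
    (PointedCone.hull ℝ ((fun ρ => latticeVec (u ρ)) '' s) : Set (Fin n → ℝ)) ∩
        PointedCone.hull ℝ ((fun ρ => latticeVec (u ρ)) '' t) =
      PointedCone.hull ℝ ((fun ρ => latticeVec (u ρ)) '' (s ∩ t))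

namespace SimplicialFan

variable {n : ℕ} {ι : Type*}

/-- The minimal generator of the ray `ρ`, in `N_ℝ`. -/
def ray (F : SimplicialFan n ι) (ρ : ι) : Fin n → ℝ := latticeVec (F.u ρ)

/-- The convex cone in `N_ℝ` generated by a set of rays. -/
def cone (F : SimplicialFan n ι) (s : Set ι) : Set (Fin n → ℝ) :=
  PointedCone.hull ℝ (F.ray '' s)

/-- The toric variety of the fan is projective: the fan is the normal fan of a full dimensional
lattice polytope. -/
def IsProjective (F : SimplicialFan n ι) : Prop :=
  ∃ V : Finset (Fin n → ℤ),
    (interior (convexHull ℝ (latticeVec '' (V : Set (Fin n → ℤ))))).Nonempty ∧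
    {σ | ∃ s ∈ F.cones, σ = F.cone s} =
      normalFan (convexHull ℝ (latticeVec '' (V : Set (Fin n → ℤ))))

/-! ### Divisors and their classes

A torus-invariant divisor `∑ a_ρ D_ρ` is the vector `a : ι → ℤ` of its coefficients. -/

/-- `m ↦ div (χ^m) = ∑ ⟨m, u_ρ⟩ D_ρ`. -/
def divHom (F : SimplicialFan n ι) : (Fin n → ℤ) →+ (ι → ℤ) where
  toFun m := fun ρ => m ⬝ᵥ F.u ρ
  map_zero' := by ext ρ; simp
  map_add' m m' := by ext ρ; simp [add_dotProduct]

/-- The class group `ℤ^{Σ(1)} / div M` of the toric variety. -/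
abbrev ClassGroup (F : SimplicialFan n ι) : Type _ := (ι → ℤ) ⧸ F.divHom.range

/-- The class of a torus-invariant divisor. -/
def divisorClass (F : SimplicialFan n ι) (a : ι → ℤ) : F.ClassGroup := QuotientAddGroup.mk a

/-- The order of the torsion part of the class group is prime to the characteristic of `K`
(no condition in characteristic zero). -/
def TorsionPrimeToChar (F : SimplicialFan n ι) (K : Type*) [Field K] : Prop :=
  (Nat.card (AddCommGroup.torsion F.ClassGroup)).Coprime (ringExpChar K)

/-- The class group degree `[D_ρ]` of the variable `x_ρ` of the Cox ring. -/
def coxWeight (F : SimplicialFan n ι) (ρ : ι) : F.ClassGroup :=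
  open Classical in F.divisorClass (Pi.single ρ 1)

/-- The graded piece `S_β` of the Cox ring `S = K[x_ρ, ρ ∈ Σ(1)]`. -/
def coxPiece (F : SimplicialFan n ι) (K : Type*) [Field K] (β : F.ClassGroup) :
    Submodule K (MvPolynomial ι K) :=
  MvPolynomial.weightedHomogeneousSubmodule K F.coxWeight β

/-- The divisor `∑ a_ρ D_ρ` is Cartier: on every affine chart `U_σ` it is the divisor of a
character. -/
def IsCartier (F : SimplicialFan n ι) (a : ι → ℤ) : Prop :=
  ∀ s ∈ F.cones, ∃ m : Fin n → ℤ, ∀ ρ ∈ s, m ⬝ᵥ F.u ρ = - a ρ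

/-- For a wall `τ ∈ Σ(n-1)` of a complete fan, `b` is a positive multiple of the class
`(C_τ · D_ρ)_ρ` of the toric curve `C_τ`. Numerical classes of curves are the linear relations
between the generators `u_ρ`; for `ρ` not in `τ`, `C_τ · D_ρ` is positive if `τ` and `ρ` span a cone
of the fan (this happens for two rays `ρ`) and zero otherwise. By linear independence of the
generators of each maximal cone these conditions determine the relation up to a positive factor. -/
def IsToricCurveClass [Fintype ι] (F : SimplicialFan n ι) (τ : Set ι) (b : ι → ℝ) : Prop :=
  ∑ ρ, b ρ • F.ray ρ = 0 ∧
  ∀ ρ, ρ ∉ τ → (insert ρ τ ∈ F.cones → 0 < b ρ) ∧ (insert ρ τ ∉ F.cones → b ρ = 0)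

/-- The divisor `D = ∑ a_ρ D_ρ` is nef: `C_τ · D ≥ 0` for the toric curves `C_τ`, whose classes
generate the cone of effective curves. -/
def IsNef [Fintype ι] (F : SimplicialFan n ι) (a : ι → ℤ) : Prop :=
  ∀ τ ∈ F.cones, τ.ncard + 1 = n → ∀ b : ι → ℝ, F.IsToricCurveClass τ b →
    0 ≤ ∑ ρ, (a ρ : ℝ) * b ρ

/-- The polytope `P_D ⊆ M_ℝ` of the divisor `D = ∑ a_ρ D_ρ`. -/
def divisorPolytope (F : SimplicialFan n ι) (a : ι → ℤ) : Set (Fin n → ℝ) :=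
  {m | ∀ ρ, - (a ρ : ℝ) ≤ m ⬝ᵥ F.ray ρ}

/-- The possibly degenerate fan `Σ_[D]`: the normal fan of `P_D`. Changing `D` in its class
translates `P_D` and does not change this fan. -/
def divisorFan (F : SimplicialFan n ι) (a : ι → ℤ) : Set (Set (Fin n → ℝ)) :=
  normalFan (F.divisorPolytope a)

/-! ### Points of the toric variety -/

/-- The semigroup `S_σ = σ^∨ ∩ M`. -/
def dualMonoid (F : SimplicialFan n ι) (s : Set ι) : AddSubmonoid (Fin n → ℤ) where
  carrier := {m | ∀ ρ ∈ s, 0 ≤ m ⬝ᵥ F.u ρ}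
  zero_mem' := by intro ρ _; simp
  add_mem' := by
    intro m m' hm hm' ρ hρ
    rw [add_dotProduct]
    exact add_nonneg (hm ρ hρ) (hm' ρ hρ)

theorem dualMonoid_anti (F : SimplicialFan n ι) {s t : Set ι} (h : s ⊆ t) :
    F.dualMonoid t ≤ F.dualMonoid s := fun _ hm ρ hρ => hm ρ (h hρ)

/-- The `L`-points of the affine chart `U_σ = Spec K[S_σ]`: the semigroup homomorphisms from `S_σ`
to `(L, ·)`. -/
abbrev ChartPoint (F : SimplicialFan n ι) (L : Type*) [Field L] (s : Set ι) : Type _ :=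
  Multiplicative (F.dualMonoid s) →* L

/-- The inclusion `U_τ(L) → U_σ(L)` for a face `τ` of `σ`. -/
def ChartPoint.incl {F : SimplicialFan n ι} {L : Type*} [Field L] {s t : Set ι} (h : s ⊆ t)
    (γ : F.ChartPoint L s) : F.ChartPoint L t :=
  γ.comp (AddMonoidHom.toMultiplicative (AddSubmonoid.inclusion (F.dualMonoid_anti h)))

/-- Identification of an `L`-point of `U_τ` with its image in `U_σ`, for `τ` a face of `σ`. -/
def GlueRel (F : SimplicialFan n ι) (L : Type*) [Field L]
    (p q : Σ s : F.cones, F.ChartPoint L s.1) : Prop :=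
  ∃ h : p.1.1 ⊆ q.1.1, q.2 = ChartPoint.incl h p.2

/-- The set `X_Σ(L)` of `L`-points of the toric variety of the fan, for a field `L`: the sets
`U_σ(L)` glued along the inclusions of faces. -/
def Points (F : SimplicialFan n ι) (L : Type*) [Field L] : Type _ :=
  Quot (F.GlueRel L)

/-- Extension of scalars `X_Σ(K) → X_Σ(L)`. -/
def Points.baseChange {F : SimplicialFan n ι} {K : Type*} [Field K] (L : Type*) [Field L]
    [Algebra K L] : F.Points K → F.Points L :=
  Quot.map (fun p => ⟨p.1, (algebraMap K L : K →* L).comp p.2⟩) (by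
    rintro ⟨s, γ⟩ ⟨t, δ⟩ ⟨h, hδ⟩
    refine ⟨h, ?_⟩
    dsimp only at hδ ⊢
    rw [hδ]
    rfl)

variable [Fintype ι]

/-- The exceptional set `Z(Σ)`: the common zeros of the monomials `∏_{ρ ∉ σ(1)} x_ρ`, `σ ∈ Σ`. -/
def exceptionalSet (F : SimplicialFan n ι) (L : Type*) [Field L] : Set (ι → L) :=
  open Classical in {x | ∀ s ∈ F.cones, ∏ ρ with ρ ∉ s, x ρ = 0}

theorem zeroSet_mem (F : SimplicialFan n ι) {L : Type*} [Field L] {x : ι → L}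
    (hx : x ∉ F.exceptionalSet L) : {ρ | x ρ = 0} ∈ F.cones := by
  classical
  simp only [exceptionalSet, Set.mem_ofPred_eq, not_forall] at hx
  obtain ⟨s, hs, hne⟩ := hx
  refine F.face_mem s hs _ fun ρ hρ => ?_
  by_contra hns
  exact hne (Finset.prod_eq_zero (by simpa using hns) hρ)

/-- The point of `U_σ` with homogeneous coordinates `x`, where `σ` is the cone spanned by the rays
`ρ` with `x_ρ = 0`: the semigroup homomorphism `m ↦ ∏ x_ρ ^ ⟨m, u_ρ⟩`. -/
def coxChartPoint (F : SimplicialFan n ι) {L : Type*} [Field L] (x : ι → L) :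
    F.ChartPoint L {ρ | x ρ = 0} where
  toFun m := ∏ ρ, x ρ ^ ((m.toAdd : Fin n → ℤ) ⬝ᵥ F.u ρ)
  map_one' := by simp
  map_mul' m m' := by
    rw [← Finset.prod_mul_distrib]
    refine Finset.prod_congr rfl fun ρ _ => ?_
    simp only [toAdd_mul, AddSubmonoid.coe_add, add_dotProduct]
    by_cases hρ : x ρ = 0
    · have h1 : 0 ≤ (m.toAdd : Fin n → ℤ) ⬝ᵥ F.u ρ := m.toAdd.2 ρ hρ
      have h2 : 0 ≤ (m'.toAdd : Fin n → ℤ) ⬝ᵥ F.u ρ := m'.toAdd.2 ρ hρ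
      obtain ⟨a, ha⟩ := Int.eq_ofNat_of_zero_le h1
      obtain ⟨b, hb⟩ := Int.eq_ofNat_of_zero_le h2
      rw [ha, hb, ← Nat.cast_add]
      simp only [zpow_natCast, pow_add]
    · exact zpow_add₀ hρ _ _

/-- The Cox quotient map `π : L^{Σ(1)} \ Z(Σ) → X_Σ(L)`. -/
def coxMap (F : SimplicialFan n ι) {L : Type*} [Field L] (x : ι → L)
    (hx : x ∉ F.exceptionalSet L) : F.Points L :=
  Quot.mk _ ⟨⟨{ρ | x ρ = 0}, F.zeroSet_mem hx⟩, F.coxChartPoint x⟩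

/-- The `L`-valued points `{π(x) | x ∈ L^{Σ(1)} \ Z(Σ), f(x) = 0}` of `X_Σ`. For `L` algebraically
closed this is the set of all `L`-points of the hypersurface `V(f)`. -/
def zeroLocus (F : SimplicialFan n ι) {K : Type*} [Field K] (f : MvPolynomial ι K)
    (L : Type*) [Field L] [Algebra K L] : Set (F.Points L) :=
  {p | ∃ (x : ι → L) (hx : x ∉ F.exceptionalSet L),
    MvPolynomial.aeval x f = 0 ∧ F.coxMap x hx = p}

/-- The `K`-rational points of the hypersurface `V(f)`: the `K`-points of `X_Σ` which lie on `V(f)`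
over the algebraic closure of `K`. -/
def rationalPoints (F : SimplicialFan n ι) {K : Type*} [Field K] (f : MvPolynomial ι K) :
    Set (F.Points K) :=
  {p | p.baseChange (AlgebraicClosure K) ∈ F.zeroLocus f (AlgebraicClosure K)}

end SimplicialFan

end

/-!
The key fact is that a nef Cartier divisor `D` on a projective toric variety is basepoint free: for
every cone `s` of the fan there is a point `p_s` of the polytope `P_D` with `⟨p_s, u_ρ⟩ = -a_ρ` for
all `ρ ∈ s` (`exists_mem_divisorPolytope`). For a maximal cone, `p_s` is given by the Cartier
condition, and the inequality at a ray `ρ₀` is proved by walking towards `ρ₀` from one maximal cone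
to an adjacent one, as in the simplex method: nonnegativity on the curve of the wall that is crossed
shows that the value at `u_{ρ₀}` does not increase, and the support function of an ample polytope,
which strictly decreases, bounds the walk (`mem_divisorPolytope_of_isNef`). The walls, the adjacent
cones and the relations giving the curve classes come from completeness of the fan
(`exists_wall_relation`, `isToricCurveClass_of_wall_relation`).

Basepoint freeness shows that each cone of `Σ` lies in a cone of `Σ_[D]`, which is one implication.
For the other, let the vanishing coordinates `T` of a root `α` lie in a cone of `Σ_[D]`, and let `τ`
be the cone of `Σ` whose relative interior contains `∑_{ρ ∈ T} u_ρ`. Then `T` and `τ` are normal to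
the same face of `P_D`, so a monomial of `f` involves a variable of `T` if and only if it involves a
variable of `τ`. Setting the coordinates in `τ` to `0` and those in `T \ τ` to `1` thus
preserves the value of `f`, and the new root has its zero set in `Σ`
(`exists_root_zeroSet_mem_cones`). Its image under the Cox quotient map is a rational point of `D`.

Points of cones are handled through coordinate functions `c : ι → ℝ` on all rays, supported on the
rays of the cone.
-/

namespace SimplicialFan

variable {n : ℕ} {ι : Type*} (F : SimplicialFan n ι)

/-! ### Cones and coordinates of their points -/

theorem ray_mem_cone {s : Set ι} {ρ : ι} (h : ρ ∈ s) : F.ray ρ ∈ F.cone s :=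
  Submodule.subset_span ⟨ρ, h, rfl⟩

theorem ray_ne_zero (ρ : ι) : F.ray ρ ≠ 0 := by
  have := (F.linearIndependent {ρ} (F.ray_mem ρ)).ne_zero ⟨ρ, rfl⟩
  exact this

theorem cone_inter_cone {s t : Set ι} (hs : s ∈ F.cones) (ht : t ∈ F.cones) :
    F.cone s ∩ F.cone t = F.cone (s ∩ t) := F.inter_eq s hs t ht

theorem mem_of_ray_mem_cone {s : Set ι} (hs : s ∈ F.cones) {ρ : ι} (h : F.ray ρ ∈ F.cone s) :
    ρ ∈ s := by
  by_contra hρ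
  have h1 : F.ray ρ ∈ F.cone {ρ} ∩ F.cone s := ⟨F.ray_mem_cone rfl, h⟩
  rw [F.cone_inter_cone (F.ray_mem ρ) hs, Set.singleton_inter_eq_empty.2 hρ] at h1
  simp only [cone, Set.image_empty, PointedCone.hull, Submodule.span_empty] at h1
  exact F.ray_ne_zero ρ (by simpa using h1)

theorem exists_mem_cone (hproj : F.IsProjective) (w : Fin n → ℝ) : ∃ s ∈ F.cones, w ∈ F.cone s := by
  obtain ⟨V, hint, hV⟩ := hproj
  set P := convexHull ℝ (latticeVec '' (V : Set (Fin n → ℤ)))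
  have hne : P.Nonempty := hint.mono interior_subset
  have hcomp : IsCompact P := (V.finite_toSet.image _).isCompact_convexHull ℝ
  obtain ⟨q, hq, hmin⟩ := hcomp.exists_isMinOn hne
    (f := fun p => p ⬝ᵥ w) (by unfold dotProduct; fun_prop)
  have hmem : innerNormalCone P (polytopeFace P w) ∈ normalFan P := ⟨w, ⟨q, hq, hmin⟩, rfl⟩
  rw [← hV] at hmem
  obtain ⟨s, hs, heq⟩ := hmem
  exact ⟨s, hs, heq ▸ fun q hq p hp => hq.2 p hp⟩

/-- The cones of a normal fan are intersections of closed half-spaces. -/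
theorem isClosed_cone (hproj : F.IsProjective) {s : Set ι} (hs : s ∈ F.cones) :
    IsClosed (F.cone s) := by
  obtain ⟨V, -, hV⟩ := hproj
  have hmem : F.cone s ∈ {σ | ∃ s ∈ F.cones, σ = F.cone s} := ⟨s, hs, rfl⟩
  rw [hV] at hmem
  obtain ⟨w, -, heq⟩ := hmem
  rw [heq]
  simp only [innerNormalCone, Set.ofPred_forall]
  refine isClosed_iInter fun q => isClosed_iInter fun _ => isClosed_iInter fun p =>
    isClosed_iInter fun _ => isClosed_le ?_ ?_ <;> unfold dotProduct <;> fun_prop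

theorem latticeVec_dotProduct_ray (m : Fin n → ℤ) (ρ : ι) :
    latticeVec m ⬝ᵥ F.ray ρ = ((m ⬝ᵥ F.u ρ : ℤ) : ℝ) := by
  simp [latticeVec, ray, dotProduct]

variable [Fintype ι]

theorem mem_cone_of_coeff {s : Set ι} (c : ι → ℝ) (h0 : ∀ ρ, 0 ≤ c ρ)
    (hc : ∀ ρ, ρ ∉ s → c ρ = 0) : ∑ ρ, c ρ • F.ray ρ ∈ F.cone s := by
  refine Submodule.sum_mem _ fun ρ _ => ?_
  by_cases hρ : ρ ∈ s
  · exact Submodule.smul_mem _ (⟨c ρ, h0 ρ⟩ : {r : ℝ // 0 ≤ r}) (F.ray_mem_cone hρ)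
  · rw [hc ρ hρ, zero_smul]
    exact Submodule.zero_mem _

theorem exists_coeff_of_mem_cone {s : Set ι} {w : Fin n → ℝ} (hw : w ∈ F.cone s) :
    ∃ c : ι → ℝ, (∀ ρ, 0 ≤ c ρ) ∧ (∀ ρ, ρ ∉ s → c ρ = 0) ∧ ∑ ρ, c ρ • F.ray ρ = w := by
  classical
  change w ∈ Submodule.span {r : ℝ // 0 ≤ r} (F.ray '' s) at hw
  induction hw using Submodule.span_induction with
  | mem x hx =>
    obtain ⟨ρ, hρ, rfl⟩ := hx
    refine ⟨Pi.single ρ 1, fun κ => ?_, fun κ hκ => ?_, ?_⟩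
    · by_cases h : κ = ρ
      · subst h; simp
      · simp [h]
    · exact Pi.single_eq_of_ne (by rintro rfl; exact hκ hρ) _
    · simp [Pi.single_apply, ite_smul]
  | zero => exact ⟨0, by simp, by simp, by simp⟩
  | add x y _ _ hx hy =>
    obtain ⟨c, h0, hc, rfl⟩ := hx
    obtain ⟨d, h0', hd, rfl⟩ := hy
    exact ⟨c + d, fun ρ => add_nonneg (h0 ρ) (h0' ρ), fun ρ hρ => by simp [hc ρ hρ, hd ρ hρ],
      by simp [add_smul, Finset.sum_add_distrib]⟩
  | smul r x _ hx =>
    obtain ⟨c, h0, hc, rfl⟩ := hx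
    refine ⟨fun ρ => r * c ρ, fun ρ => mul_nonneg r.2 (h0 ρ), fun ρ hρ => by simp [hc ρ hρ], ?_⟩
    simp only [mul_smul, ← Finset.smul_sum]
    rfl

theorem coeff_unique {s : Set ι} (hs : s ∈ F.cones) {c d : ι → ℝ} (hc : ∀ ρ, ρ ∉ s → c ρ = 0)
    (hd : ∀ ρ, ρ ∉ s → d ρ = 0) (h : ∑ ρ, c ρ • F.ray ρ = ∑ ρ, d ρ • F.ray ρ) : c = d := by
  classical
  have hli := Fintype.linearIndependent_iff.1 (F.linearIndependent s hs)
    (fun ρ => c ρ - d ρ) (by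
      have h1 : ∑ ρ, (c ρ - d ρ) • F.ray ρ = 0 := by
        simp [sub_smul, Finset.sum_sub_distrib, h]
      rw [← h1]
      refine Fintype.sum_of_injective _ Subtype.val_injective _ _ (fun ρ hρ => ?_) fun _ => rfl
      have hρ' : ρ ∉ s := by simpa using hρ
      rw [hc ρ hρ', hd ρ hρ', sub_zero, zero_smul])
  funext ρ
  by_cases hρ : ρ ∈ s
  · exact sub_eq_zero.1 (hli ⟨ρ, hρ⟩)
  · rw [hc ρ hρ, hd ρ hρ]

open Classical in
/-- The sum of the generators of a set of rays; for a cone of the fan, a point of its relative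
interior. -/
noncomputable def coneCenter (s : Set ι) : Fin n → ℝ :=
  ∑ ρ, (if ρ ∈ s then (1 : ℝ) else 0) • F.ray ρ

theorem subset_of_coneCenter_mem {s t : Set ι} (hs : s ∈ F.cones) (ht : t ∈ F.cones)
    (h : F.coneCenter s ∈ F.cone t) : s ⊆ t := by
  classical
  have hss : F.coneCenter s ∈ F.cone s :=
    F.mem_cone_of_coeff _ (fun ρ => by split_ifs <;> norm_num) (fun ρ hρ => if_neg hρ)
  have h1 : F.coneCenter s ∈ F.cone s ∩ F.cone t := ⟨hss, h⟩
  rw [F.cone_inter_cone hs ht] at h1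
  obtain ⟨c, -, hc, hsum⟩ := F.exists_coeff_of_mem_cone h1
  have := F.coeff_unique hs (fun ρ hρ => hc ρ fun h => hρ h.1) (fun ρ hρ => if_neg hρ) hsum
  intro ρ hρ
  by_contra hρt
  have h2 := congrFun this ρ
  rw [hc ρ fun h => hρt h.2, if_pos hρ] at h2
  exact zero_ne_one h2

theorem ncard_le {s : Set ι} (hs : s ∈ F.cones) : s.ncard ≤ n := by
  classical
  have := (F.linearIndependent s hs).fintype_card_le_finrank
  rwa [Module.finrank_fin_fun, ← Nat.card_eq_fintype_card] at this

theorem exists_coeff_of_ncard_eq {s : Set ι} (hs : s ∈ F.cones) (hn : s.ncard = n)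
    (w : Fin n → ℝ) : ∃ c : ι → ℝ, (∀ ρ, ρ ∉ s → c ρ = 0) ∧ ∑ ρ, c ρ • F.ray ρ = w := by
  classical
  have hcard : Fintype.card s = Module.finrank ℝ (Fin n → ℝ) := by
    rw [Module.finrank_fin_fun, ← Nat.card_eq_fintype_card]; exact hn
  have hspan := (F.linearIndependent s hs).span_eq_top_of_card_eq_finrank' hcard
  have hw : w ∈ Submodule.span ℝ (Set.range fun ρ : s => F.ray ρ) := by
    have : w ∈ (⊤ : Submodule ℝ (Fin n → ℝ)) := trivial
    rwa [← hspan] at this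
  obtain ⟨c, hc⟩ := (Submodule.mem_span_range_iff_exists_fun ℝ).1 hw
  refine ⟨fun ρ => if h : ρ ∈ s then c ⟨ρ, h⟩ else 0, fun ρ hρ => dif_neg hρ, ?_⟩
  rw [← hc]
  refine (Fintype.sum_of_injective _ Subtype.val_injective _ _ (fun ρ hρ => ?_) fun ρ => ?_).symm
  · have hρ' : ρ ∉ s := by simpa using hρ
    simp [hρ']
  · simp

/-! ### Complete fans and their walls -/

/-- From any point `w`, a small step in any direction `v` stays inside one cone of the fan
containing `w`: the cones are closed, finite in number, and cover the space. -/
theorem exists_cone_mem_add_smul (hproj : F.IsProjective) (w v : Fin n → ℝ) :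
    ∃ t ∈ F.cones, w ∈ F.cone t ∧ ∃ ε : ℝ, 0 < ε ∧ w + ε • v ∈ F.cone t := by
  have hU : IsClosed (⋃ t ∈ {t ∈ F.cones | w ∉ F.cone t}, F.cone t) :=
    (Set.toFinite _).isClosed_biUnion fun t ht => F.isClosed_cone hproj ht.1
  have hw : w ∈ (⋃ t ∈ {t ∈ F.cones | w ∉ F.cone t}, F.cone t)ᶜ := by
    simp only [Set.mem_compl_iff, Set.mem_iUnion, not_exists]
    exact fun t ht => ht.2
  have hcont : Filter.Tendsto (fun ε : ℝ => w + ε • v) (nhdsWithin 0 (Set.Ioi 0)) (nhds w) := by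
    have : Continuous fun ε : ℝ => w + ε • v := by fun_prop
    simpa using (this.tendsto 0).mono_left nhdsWithin_le_nhds
  obtain ⟨ε, hε, hpos⟩ := ((hcont.eventually (hU.isOpen_compl.mem_nhds hw)).and
    self_mem_nhdsWithin).exists
  obtain ⟨t, ht, hmem⟩ := F.exists_mem_cone hproj (w + ε • v)
  refine ⟨t, ht, ?_, ε, hpos, hmem⟩
  by_contra hwt
  exact hε (Set.mem_biUnion (show t ∈ {t ∈ F.cones | w ∉ F.cone t} from ⟨ht, hwt⟩) hmem)

/-- A cone maximal under inclusion spans the space, since otherwise a small step from its center in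
a direction outside its span would lie in a larger cone. -/
theorem exists_maximal_cone (hproj : F.IsProjective) {s : Set ι} (hs : s ∈ F.cones) :
    ∃ t ∈ F.cones, s ⊆ t ∧ t.ncard = n := by
  classical
  obtain ⟨t, hst, ⟨ht, hmax⟩⟩ := (Set.toFinite F.cones).exists_le_maximal hs
  refine ⟨t, ht, hst, ?_⟩
  have hspan : ⊤ ≤ Submodule.span ℝ (Set.range fun ρ : t => F.ray ρ) := by
    intro v _
    obtain ⟨t', ht', h0, ε, hε, h1⟩ := F.exists_cone_mem_add_smul hproj (F.coneCenter t) v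
    have hsub := F.subset_of_coneCenter_mem ht ht' h0
    have htt : t' = t := (hmax ht' hsub).antisymm hsub
    subst htt
    have key : ∀ x ∈ F.cone t', x ∈ Submodule.span ℝ (Set.range fun ρ : t' => F.ray ρ) := by
      intro x hx
      obtain ⟨c, -, hc, rfl⟩ := F.exists_coeff_of_mem_cone hx
      refine Submodule.sum_mem _ fun ρ _ => ?_
      by_cases hρ : ρ ∈ t'
      · exact Submodule.smul_mem _ _ (Submodule.subset_span ⟨⟨ρ, hρ⟩, rfl⟩)
      · rw [hc ρ hρ, zero_smul]; exact Submodule.zero_mem _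
    have h2 := Submodule.sub_mem _ (key _ h1) (key _ h0)
    rw [add_sub_cancel_left] at h2
    exact (Submodule.smul_mem_iff _ hε.ne').1 h2
  have h := finrank_span_eq_card (F.linearIndependent t ht)
  change Module.finrank ℝ (Submodule.span ℝ (Set.range fun ρ : t => F.ray ρ)) = _ at h
  rw [top_le_iff.1 hspan, finrank_top, Module.finrank_fin_fun, ← Nat.card_eq_fintype_card] at h
  exact h.symm

/-- Across the wall of a maximal cone `s` opposite to `ρ₁ ∈ s` lies a maximal cone with one new ray
`ρ₂`, and a linear relation supported on `s ∪ {ρ₂}` is positive at `ρ₁` and `ρ₂`. -/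
theorem exists_wall_relation (hproj : F.IsProjective) {s : Set ι} (hs : s ∈ F.cones)
    (hn : s.ncard = n) {ρ₁ : ι} (h₁ : ρ₁ ∈ s) :
    ∃ ρ₂, ρ₂ ∉ s ∧ insert ρ₂ (s \ {ρ₁}) ∈ F.cones ∧
      ∃ b : ι → ℝ, ∑ ρ, b ρ • F.ray ρ = 0 ∧ 0 < b ρ₁ ∧ 0 < b ρ₂ ∧
        ∀ ρ, ρ ∉ s → ρ ≠ ρ₂ → b ρ = 0 := by
  classical
  have hτ : s \ {ρ₁} ∈ F.cones := F.face_mem s hs _ Set.sdiff_subset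
  obtain ⟨t, ht, h0, ε, hε, h1⟩ :=
    F.exists_cone_mem_add_smul hproj (F.coneCenter (s \ {ρ₁})) (-F.ray ρ₁)
  have hsub := F.subset_of_coneCenter_mem hτ ht h0
  obtain ⟨c, hc0, hc, hsum⟩ := F.exists_coeff_of_mem_cone h1
  -- The coordinates in `s` of the displaced point: negative at `ρ₁`.
  let e : ι → ℝ := fun ρ => (if ρ ∈ s \ {ρ₁} then 1 else 0) - (if ρ = ρ₁ then ε else 0)
  have hesum : ∑ ρ, e ρ • F.ray ρ = F.coneCenter (s \ {ρ₁}) + ε • -F.ray ρ₁ := by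
    simp only [e, sub_smul, Finset.sum_sub_distrib, coneCenter, smul_neg]
    simp [ite_smul, sub_eq_add_neg]
  have hes : ∀ ρ, ρ ∉ s → e ρ = 0 := by
    intro ρ hρ
    have : ρ ≠ ρ₁ := by rintro rfl; exact hρ h₁
    simp [e, hρ, this]
  have he₁ : e ρ₁ = -ε := by simp [e]
  have hnot : ¬ ∀ ρ, ρ ∉ s → c ρ = 0 := by
    intro hcs
    have := congrFun (F.coeff_unique hs hcs hes (hsum.trans hesum.symm)) ρ₁
    have := hc0 ρ₁
    linarith
  push Not at hnot
  obtain ⟨ρ₂, h₂s, h₂c⟩ := hnot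
  have h₂t : ρ₂ ∈ t := by
    by_contra h
    exact h₂c (hc _ h)
  have hins : insert ρ₂ (s \ {ρ₁}) ⊆ t := Set.insert_subset h₂t hsub
  have hncard : (insert ρ₂ (s \ {ρ₁})).ncard = n := by
    rw [Set.ncard_insert_of_notMem (fun h => h₂s h.1) (Set.toFinite _),
      Set.ncard_sdiff_singleton_add_one h₁ (Set.toFinite _), hn]
  have hteq : insert ρ₂ (s \ {ρ₁}) = t :=
    Set.eq_of_subset_of_ncard_le hins (by rw [hncard]; exact F.ncard_le ht) (Set.toFinite _)
  have h12 : ρ₁ ≠ ρ₂ := by rintro rfl; exact h₂s h₁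
  refine ⟨ρ₂, h₂s, hteq ▸ ht, fun ρ => c ρ - e ρ, ?_, ?_, ?_, ?_⟩
  · simp only [sub_smul, Finset.sum_sub_distrib]
    rw [hsum, hesum, sub_self]
  · have : c ρ₁ = 0 := hc _ (by rw [← hteq]; simp [h12])
    simp only [this, he₁]
    linarith
  · simp only [hes _ h₂s, sub_zero]
    exact lt_of_le_of_ne (hc0 _) (Ne.symm h₂c)
  · intro ρ hρs hρ
    have : ρ ∉ t := by rw [← hteq]; simp [hρ, hρs]
    simp [hc _ this, hes _ hρs]

/-- Two cones with a common wall `τ` lie on different sides of it. -/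
theorem not_mem_cones_of_same_side {s τ : Set ι} (hs : s ∈ F.cones) (hτs : τ ⊆ s) {ρ : ι}
    (hρ : ρ ∉ s) {c : ι → ℝ} (hc : ∀ κ, κ ∉ s → c κ = 0) (h0 : ∀ κ, κ ∉ τ → 0 ≤ c κ)
    (hsum : ∑ κ, c κ • F.ray κ = F.ray ρ) : insert ρ τ ∉ F.cones := by
  classical
  intro hins
  -- Adding a large vector of the wall moves the generator of `ρ` into the cone of `s`.
  let d : ι → ℝ := fun κ => if κ ∈ τ then |c κ| else 0
  have hd0 : ∀ κ, 0 ≤ d κ := fun κ => by simp only [d]; split_ifs <;> positivity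
  have hx : ∑ κ, (d κ + c κ) • F.ray κ = ∑ κ, (d κ + if κ = ρ then 1 else 0) • F.ray κ := by
    simp only [add_smul, Finset.sum_add_distrib, hsum]
    simp [ite_smul]
  have hd : ∀ κ, κ ∉ τ → d κ = 0 := fun κ hκ => if_neg hκ
  have hm1 : ∑ κ, (d κ + c κ) • F.ray κ ∈ F.cone s := by
    refine F.mem_cone_of_coeff _ (fun κ => ?_) fun κ hκ => ?_
    · by_cases hκ : κ ∈ τ
      · simp only [d, if_pos hκ]; linarith [neg_abs_le (c κ)]
      · exact add_nonneg (hd0 κ) (h0 κ hκ)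
    · rw [hd κ fun h => hκ (hτs h), hc κ hκ, add_zero]
  have hoff : ∀ κ, κ ∉ insert ρ τ → (d κ + if κ = ρ then 1 else 0) = 0 := by
    intro κ hκ
    rw [Set.mem_insert_iff, not_or] at hκ
    rw [hd κ hκ.2, if_neg hκ.1, add_zero]
  have hm2 : ∑ κ, (d κ + c κ) • F.ray κ ∈ F.cone (insert ρ τ) := by
    rw [hx]
    refine F.mem_cone_of_coeff _ (fun κ => add_nonneg (hd0 κ) ?_) hoff
    split_ifs <;> norm_num
  have hm : ∑ κ, (d κ + c κ) • F.ray κ ∈ F.cone s ∩ F.cone (insert ρ τ) := ⟨hm1, hm2⟩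
  rw [F.cone_inter_cone hs hins] at hm
  obtain ⟨g, -, hg, hgsum⟩ := F.exists_coeff_of_mem_cone hm
  have := congrFun (F.coeff_unique hins (fun κ hκ => hg κ fun h => hκ h.2) hoff
    (hgsum.trans hx)) ρ
  rw [hg ρ fun h => hρ h.1, if_pos rfl] at this
  linarith [hd0 ρ]

theorem isToricCurveClass_of_wall_relation {s : Set ι} (hs : s ∈ F.cones) (hn : s.ncard = n)
    {ρ₁ ρ₂ : ι} (h₁ : ρ₁ ∈ s) (h₂ : ρ₂ ∉ s) (hs' : insert ρ₂ (s \ {ρ₁}) ∈ F.cones) {b : ι → ℝ}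
    (hb : ∑ ρ, b ρ • F.ray ρ = 0) (hb₁ : 0 < b ρ₁) (hb₂ : 0 < b ρ₂)
    (hb0 : ∀ ρ, ρ ∉ s → ρ ≠ ρ₂ → b ρ = 0) : F.IsToricCurveClass (s \ {ρ₁}) b := by
  classical
  refine ⟨hb, fun ρ hρ => ?_⟩
  by_cases hρ₁ : ρ = ρ₁
  · subst hρ₁
    exact ⟨fun _ => hb₁, fun h => absurd (by simpa [Set.insert_eq_of_mem h₁] using hs) h⟩
  by_cases hρ₂ : ρ = ρ₂
  · subst hρ₂
    exact ⟨fun _ => hb₂, fun h => absurd hs' h⟩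
  have hρs : ρ ∉ s := fun h => hρ ⟨h, hρ₁⟩
  refine ⟨fun h => absurd h ?_, fun _ => hb0 ρ hρs hρ₂⟩
  obtain ⟨c, hc, hsum⟩ := F.exists_coeff_of_ncard_eq hs hn (F.ray ρ)
  rcases le_or_gt 0 (c ρ₁) with hpos | hneg
  · refine F.not_mem_cones_of_same_side hs Set.sdiff_subset hρs hc (fun κ hκ => ?_) hsum
    by_cases h : κ = ρ₁
    · rwa [h]
    · rw [hc κ fun h' => hκ ⟨h', h⟩]
  · -- On the other side, the relation `b` rewrites the coordinates in terms of `ρ₂`.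
    have hk : 0 < -c ρ₁ / b ρ₁ := div_pos (by linarith) hb₁
    have h₁0 : c ρ₁ + -c ρ₁ / b ρ₁ * b ρ₁ = 0 := by field_simp; ring
    refine F.not_mem_cones_of_same_side hs' (Set.subset_insert _ _) (ρ := ρ) (by simp [hρ₂, hρs])
      (c := fun κ => c κ + -c ρ₁ / b ρ₁ * b κ) (fun κ hκ => ?_) (fun κ hκ => ?_) ?_
    · by_cases h : κ = ρ₁
      · rw [h, h₁0]
      · have hκs : κ ∉ s := fun h' => hκ (Or.inr ⟨h', h⟩)
        rw [hc κ hκs, hb0 κ hκs fun h' => hκ (Or.inl h'), mul_zero, add_zero]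
    · by_cases h : κ = ρ₁
      · rw [h, h₁0]
      · have hκs : κ ∉ s := fun h' => hκ ⟨h', h⟩
        rw [hc κ hκs, zero_add]
        refine mul_nonneg hk.le ?_
        by_cases h' : κ = ρ₂
        · rw [h']; exact hb₂.le
        · rw [hb0 κ hκs h']
    · simp only [add_smul, Finset.sum_add_distrib, mul_smul, ← Finset.smul_sum, hb, hsum]
      simp

/-! ### Nef Cartier divisors are generated by global sections -/

theorem dotProduct_sum_smul_ray (m : Fin n → ℝ) (c : ι → ℝ) :
    m ⬝ᵥ ∑ ρ, c ρ • F.ray ρ = ∑ ρ, c ρ * (m ⬝ᵥ F.ray ρ) := by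
  simp [dotProduct_sum, dotProduct_smul]

theorem eq_of_dotProduct_ray_eq {s : Set ι} (hs : s ∈ F.cones) (hn : s.ncard = n)
    {p q : Fin n → ℝ} (h : ∀ ρ ∈ s, p ⬝ᵥ F.ray ρ = q ⬝ᵥ F.ray ρ) : p = q := by
  refine dotProduct_eq _ _ fun w => ?_
  obtain ⟨c, hc, rfl⟩ := F.exists_coeff_of_ncard_eq hs hn w
  rw [dotProduct_sum_smul_ray, dotProduct_sum_smul_ray]
  refine Finset.sum_congr rfl fun ρ _ => ?_
  by_cases hρ : ρ ∈ s
  · rw [h ρ hρ]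
  · simp [hc ρ hρ]

/-- A polytope defining a projective fan provides a strictly convex piecewise linear function:
`q s` is a point of the face dual to the cone `s`, a vertex for maximal cones. On a generator of `s`
the value at `q s` is minimal, and a vertex `q t` attains it only if `t` contains that ray. -/
theorem exists_strictly_convex (hproj : F.IsProjective) :
    ∃ q : Set ι → Fin n → ℝ, ∀ s ∈ F.cones, ∀ t ∈ F.cones, t.ncard = n → ∀ ρ ∈ s,
      q s ⬝ᵥ F.ray ρ ≤ q t ⬝ᵥ F.ray ρ ∧ (q s ⬝ᵥ F.ray ρ = q t ⬝ᵥ F.ray ρ → ρ ∈ t) := by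
  obtain ⟨V, -, hV⟩ := hproj
  set P := convexHull ℝ (latticeVec '' (V : Set (Fin n → ℤ)))
  have hface : ∀ s, ∃ q, s ∈ F.cones → ∃ w, q ∈ polytopeFace P w ∧
      F.cone s = innerNormalCone P (polytopeFace P w) := by
    intro s
    by_cases hs : s ∈ F.cones
    · have hmem : F.cone s ∈ {σ | ∃ s ∈ F.cones, σ = F.cone s} := ⟨s, hs, rfl⟩
      rw [hV] at hmem
      obtain ⟨w, ⟨q, hq⟩, heq⟩ := hmem
      exact ⟨q, fun _ => ⟨w, hq, heq⟩⟩
    · exact ⟨0, fun h => absurd h hs⟩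
  choose q hq using hface
  refine ⟨q, fun s hs t ht hn ρ hρ => ?_⟩
  obtain ⟨w, hqs, hws⟩ := hq s hs
  obtain ⟨v, hqt, hvt⟩ := hq t ht
  have hmin : ∀ p ∈ P, q s ⬝ᵥ F.ray ρ ≤ p ⬝ᵥ F.ray ρ := by
    have := F.ray_mem_cone hρ
    rw [hws] at this
    exact this _ hqs
  refine ⟨hmin _ hqt.1, fun heq => F.mem_of_ray_mem_cone ht ?_⟩
  rw [hvt]
  intro p hp r hr
  -- The face belonging to the maximal cone `t` is the single vertex `q t`.
  have hpq : p = q t := by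
    refine F.eq_of_dotProduct_ray_eq ht hn fun κ hκ => ?_
    have := F.ray_mem_cone hκ
    rw [hvt] at this
    exact le_antisymm (this _ hp _ hqt.1) (this _ hqt _ hp.1)
  rw [hpq, ← heq]
  exact hmin r hr

/-- For a nef divisor, the linear form `m` that computes it on a maximal cone satisfies all the
inequalities of the polytope. If it failed at a ray `ρ₀`, crossing a wall towards `ρ₀` would give
another such maximal cone, by nonnegativity on the curve of that wall; strict convexity of the
function of an ample polytope prevents this from going on forever. -/
theorem mem_divisorPolytope_of_isNef (hproj : F.IsProjective) {a : ι → ℤ} (hnef : F.IsNef a)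
    (m : Set ι → Fin n → ℝ) (hm : ∀ s ∈ F.cones, ∀ ρ ∈ s, m s ⬝ᵥ F.ray ρ = -(a ρ : ℝ))
    {s : Set ι} (hs : s ∈ F.cones) (hn : s.ncard = n) : m s ∈ F.divisorPolytope a := by
  classical
  obtain ⟨q, hq⟩ := F.exists_strictly_convex hproj
  intro ρ₀
  by_contra hlt
  -- Among the maximal cones violating the inequality at `ρ₀`, take one with `q` minimal.
  let B : Set (Set ι) := {t | t ∈ F.cones ∧ t.ncard = n ∧ ¬ -(a ρ₀ : ℝ) ≤ m t ⬝ᵥ F.ray ρ₀}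
  obtain ⟨t, ⟨ht, htn, htlt⟩, hmin⟩ := B.toFinite.exists_minimalFor
    (fun t => q t ⬝ᵥ F.ray ρ₀) B ⟨s, hs, hn, hlt⟩
  obtain ⟨c, hc, hsum⟩ := F.exists_coeff_of_ncard_eq ht htn (F.ray ρ₀)
  by_cases hcpos : ∀ ρ, 0 ≤ c ρ
  · have hmem := F.mem_cone_of_coeff c hcpos hc
    rw [hsum] at hmem
    exact htlt (hm t ht ρ₀ (F.mem_of_ray_mem_cone ht hmem)).ge
  push Not at hcpos
  obtain ⟨ρ₁, hneg⟩ := hcpos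
  have h₁ : ρ₁ ∈ t := by
    by_contra h
    rw [hc _ h] at hneg
    exact lt_irrefl _ hneg
  obtain ⟨ρ₂, h₂, ht', b, hb, hb₁, hb₂, hb0⟩ := F.exists_wall_relation hproj ht htn h₁
  have h12 : ρ₁ ≠ ρ₂ := by rintro rfl; exact h₂ h₁
  have hcurve := F.isToricCurveClass_of_wall_relation ht htn h₁ h₂ ht' hb hb₁ hb₂ hb0
  have hτcard : (t \ {ρ₁}).ncard + 1 = n := by
    rw [Set.ncard_sdiff_singleton_add_one h₁ (Set.toFinite _), htn]
  have hn' : (insert ρ₂ (t \ {ρ₁})).ncard = n := by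
    rw [Set.ncard_insert_of_notMem (fun h => h₂ h.1) (Set.toFinite _), hτcard]
  have hnonneg := hnef _ (F.face_mem t ht _ Set.sdiff_subset) hτcard b hcurve
  set t' := insert ρ₂ (t \ {ρ₁}) with ht'_def
  -- A linear form vanishing on the wall has the same sign at `ρ₀` and at `ρ₂`.
  have hside : ∀ p r : Fin n → ℝ, (∀ ρ ∈ t \ {ρ₁}, p ⬝ᵥ F.ray ρ = r ⬝ᵥ F.ray ρ) →
      b ρ₁ * ((p - r) ⬝ᵥ F.ray ρ₀) = -c ρ₁ * b ρ₂ * ((p - r) ⬝ᵥ F.ray ρ₂) := by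
    intro p r hpr
    have hz : ∀ ρ ∈ t \ {ρ₁}, (p - r) ⬝ᵥ F.ray ρ = 0 := fun ρ hρ => by
      rw [sub_dotProduct, hpr ρ hρ, sub_self]
    have e1 : (p - r) ⬝ᵥ F.ray ρ₀ = c ρ₁ * ((p - r) ⬝ᵥ F.ray ρ₁) := by
      rw [← hsum, dotProduct_sum_smul_ray]
      refine Finset.sum_eq_single ρ₁ (fun ρ _ hρ => ?_) (by simp)
      by_cases hρt : ρ ∈ t
      · rw [hz ρ ⟨hρt, hρ⟩, mul_zero]
      · rw [hc ρ hρt, zero_mul]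
    have e2 : b ρ₁ * ((p - r) ⬝ᵥ F.ray ρ₁) + b ρ₂ * ((p - r) ⬝ᵥ F.ray ρ₂) = 0 := by
      have := F.dotProduct_sum_smul_ray (p - r) b
      rw [hb, dotProduct_zero] at this
      refine (this.trans (Fintype.sum_eq_add ρ₁ ρ₂ h12 fun ρ hρ => ?_)).symm
      by_cases hρt : ρ ∈ t
      · rw [hz ρ ⟨hρt, hρ.1⟩, mul_zero]
      · rw [hb0 ρ hρt hρ.2, zero_mul]
    rw [e1]
    linear_combination c ρ₁ * e2
  have hk : 0 < -c ρ₁ * b ρ₂ := mul_pos (by linarith) hb₂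
  -- Nefness on the wall: the form of `t` satisfies the inequality at `ρ₂`.
  have hρ₂ : -(a ρ₂ : ℝ) ≤ m t ⬝ᵥ F.ray ρ₂ := by
    have e := F.dotProduct_sum_smul_ray (m t) b
    rw [hb, dotProduct_zero] at e
    have e3 : ∑ ρ, (a ρ : ℝ) * b ρ = b ρ₂ * (a ρ₂ + m t ⬝ᵥ F.ray ρ₂) := by
      rw [← add_zero (∑ ρ, (a ρ : ℝ) * b ρ), e, ← Finset.sum_add_distrib]
      rw [Finset.sum_eq_single ρ₂ (fun ρ _ hρ => ?_) (by simp)]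
      · ring
      · by_cases hρt : ρ ∈ t
        · rw [hm t ht ρ hρt]; ring
        · rw [hb0 ρ hρt hρ]; ring
    rw [e3] at hnonneg
    have := nonneg_of_mul_nonneg_right hnonneg hb₂
    linarith
  have hm_le : m t' ⬝ᵥ F.ray ρ₀ ≤ m t ⬝ᵥ F.ray ρ₀ := by
    have e := hside (m t') (m t) fun ρ hρ => by
      rw [hm t' ht' ρ (Or.inr hρ), hm t ht ρ hρ.1]
    have e4 : (m t' - m t) ⬝ᵥ F.ray ρ₂ ≤ 0 := by
      rw [sub_dotProduct, hm t' ht' ρ₂ (Or.inl rfl)]; linarith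
    have e5 : b ρ₁ * ((m t' - m t) ⬝ᵥ F.ray ρ₀) ≤ 0 :=
      e ▸ mul_nonpos_of_nonneg_of_nonpos hk.le e4
    have := nonpos_of_mul_nonpos_right e5 hb₁
    rw [sub_dotProduct] at this
    linarith
  have hq_lt : q t' ⬝ᵥ F.ray ρ₀ < q t ⬝ᵥ F.ray ρ₀ := by
    have e := hside (q t') (q t) fun ρ hρ =>
      le_antisymm (hq t' ht' t ht htn ρ (Or.inr hρ)).1 (hq t ht t' ht' hn' ρ hρ.1).1
    have hlt₂ : q t' ⬝ᵥ F.ray ρ₂ < q t ⬝ᵥ F.ray ρ₂ := by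
      obtain ⟨hle, heq⟩ := hq t' ht' t ht htn ρ₂ (Or.inl rfl)
      exact lt_of_le_of_ne hle fun h => h₂ (heq h)
    have e5 : b ρ₁ * ((q t' - q t) ⬝ᵥ F.ray ρ₀) < 0 := by
      rw [e]
      refine mul_neg_of_pos_of_neg hk ?_
      rw [sub_dotProduct]; linarith
    have := (pos_iff_neg_of_mul_neg e5).1 hb₁
    rw [sub_dotProduct] at this
    linarith
  have hB : t' ∈ B := ⟨ht', hn', fun h => htlt (h.trans hm_le)⟩
  exact absurd (hmin hB hq_lt.le) (not_le.2 hq_lt)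

/-- A nef Cartier divisor is basepoint free: every cone of the fan is normal to a nonempty face of
the polytope of the divisor. -/
theorem exists_mem_divisorPolytope (hproj : F.IsProjective) {a : ι → ℤ} (hCartier : F.IsCartier a)
    (hnef : F.IsNef a) {s : Set ι} (hs : s ∈ F.cones) :
    ∃ p ∈ F.divisorPolytope a, ∀ ρ ∈ s, p ⬝ᵥ F.ray ρ = -(a ρ : ℝ) := by
  have hm : ∀ t, ∃ m : Fin n → ℝ, t ∈ F.cones → ∀ ρ ∈ t, m ⬝ᵥ F.ray ρ = -(a ρ : ℝ) := by
    intro t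
    by_cases ht : t ∈ F.cones
    · obtain ⟨m, hm⟩ := hCartier t ht
      exact ⟨latticeVec m, fun _ ρ hρ => by rw [latticeVec_dotProduct_ray, hm ρ hρ]; push_cast; rfl⟩
    · exact ⟨0, fun h => absurd h ht⟩
  choose m hm using hm
  obtain ⟨t, ht, hst, hn⟩ := F.exists_maximal_cone hproj hs
  exact ⟨m t, F.mem_divisorPolytope_of_isNef hproj hnef m hm ht hn, fun ρ hρ => hm t ht ρ (hst hρ)⟩

/-! ### Monomials of a form in the Cox ring -/

/-- The exponents of a monomial of degree `[D]` are the coefficients of `D + div (χ^m)` for some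
character `m`. -/
theorem exists_character_of_mem_support {K : Type*} [Field K] {a : ι → ℤ} {f : MvPolynomial ι K}
    (hf : f ∈ F.coxPiece K (F.divisorClass a)) {d : ι →₀ ℕ} (hd : d ∈ f.support) :
    ∃ m : Fin n → ℝ, ∀ ρ, (d ρ : ℝ) = m ⬝ᵥ F.ray ρ + a ρ := by
  classical
  have h := (MvPolynomial.mem_weightedHomogeneousSubmodule _ _ _ _).1 hf
    (MvPolynomial.mem_support_iff.1 hd)
  have hw : Finsupp.weight F.coxWeight d = F.divisorClass fun ρ => (d ρ : ℤ) := by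
    rw [Finsupp.weight_apply, Finsupp.sum_fintype _ _ (by simp)]
    have : (fun ρ => (d ρ : ℤ)) = ∑ ρ, d ρ • (Pi.single ρ 1 : ι → ℤ) := by
      ext κ
      simp [Finset.sum_apply, Pi.single_apply]
    rw [this]
    simp only [divisorClass, coxWeight]
    change _ = QuotientAddGroup.mk' F.divHom.range _
    rw [map_sum]
    refine Finset.sum_congr rfl fun ρ _ => ?_
    rw [map_nsmul]
    congr!
  rw [hw] at h
  obtain ⟨m, hm⟩ := QuotientAddGroup.eq.1 h.symm
  refine ⟨latticeVec m, fun ρ => ?_⟩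
  have := congrFun hm ρ
  simp only [divHom, AddMonoidHom.coe_mk, ZeroHom.coe_mk, Pi.add_apply, Pi.neg_apply] at this
  rw [latticeVec_dotProduct_ray, this]
  push_cast
  ring

theorem eval_eq_of_forall_support {K : Type*} [Field K] {f : MvPolynomial ι K} {x y : ι → K}
    {T τ : Set ι} (hxT : ∀ ρ, x ρ = 0 ↔ ρ ∈ T) (hyτ : ∀ ρ, y ρ = 0 ↔ ρ ∈ τ)
    (hxy : ∀ ρ, ρ ∉ T → ρ ∉ τ → x ρ = y ρ)
    (h : ∀ d ∈ f.support, (∀ ρ ∈ T, d ρ = 0) ↔ ∀ ρ ∈ τ, d ρ = 0) :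
    MvPolynomial.eval x f = MvPolynomial.eval y f := by
  rw [MvPolynomial.eval_eq', MvPolynomial.eval_eq']
  refine Finset.sum_congr rfl fun d hd => congrArg _ ?_
  by_cases hT : ∀ ρ ∈ T, d ρ = 0
  · refine Finset.prod_congr rfl fun ρ _ => ?_
    by_cases h1 : ρ ∈ T
    · rw [hT ρ h1, pow_zero, pow_zero]
    by_cases h2 : ρ ∈ τ
    · rw [(h d hd).1 hT ρ h2, pow_zero, pow_zero]
    rw [hxy ρ h1 h2]
  · have hτ : ¬ ∀ ρ ∈ τ, d ρ = 0 := fun h' => hT ((h d hd).2 h')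
    push Not at hT hτ
    obtain ⟨ρ, hρ, hne⟩ := hT
    obtain ⟨κ, hκ, hne'⟩ := hτ
    rw [Finset.prod_eq_zero (Finset.mem_univ ρ) (by rw [(hxT ρ).2 hρ, zero_pow hne]),
      Finset.prod_eq_zero (Finset.mem_univ κ) (by rw [(hyτ κ).2 hκ, zero_pow hne'])]

/-! ### Moving a root to a cone of the fan -/

/-- A root whose vanishing coordinates `T` lie in one cone of the normal fan of the divisor can be
replaced by a root whose vanishing coordinates form a cone `τ` of the fan: `τ` is the cone with the
sum of the generators of `T` in its relative interior. Both `T` and `τ` are normal to the same face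
of the polytope, so the monomials of `f` that do not vanish are the same for both roots. -/
theorem exists_root_zeroSet_mem_cones {K : Type*} [Field K] (hproj : F.IsProjective) {a : ι → ℤ}
    (hCartier : F.IsCartier a) (hnef : F.IsNef a) {f : MvPolynomial ι K}
    (hf : f ∈ F.coxPiece K (F.divisorClass a)) {x : ι → K} (hx : MvPolynomial.eval x f = 0)
    {σ : Set (Fin n → ℝ)} (hσ : σ ∈ F.divisorFan a) (hxσ : ∀ ρ, x ρ = 0 → F.ray ρ ∈ σ) :
    ∃ y : ι → K, MvPolynomial.eval y f = 0 ∧ {ρ | y ρ = 0} ∈ F.cones := by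
  classical
  obtain ⟨w, ⟨q, hq⟩, rfl⟩ := hσ
  set T : Set ι := {ρ | x ρ = 0}
  have hqT : ∀ ρ ∈ T, q ⬝ᵥ F.ray ρ = -(a ρ : ℝ) := by
    intro ρ hρ
    obtain ⟨p, hp, hpρ⟩ := F.exists_mem_divisorPolytope hproj hCartier hnef (F.ray_mem ρ)
    exact le_antisymm ((hxσ ρ hρ q hq p hp).trans_eq (hpρ ρ rfl)) (hq.1 ρ)
  obtain ⟨t, ht, hwt⟩ := F.exists_mem_cone hproj (F.coneCenter T)
  obtain ⟨c, hc0, hct, hsum⟩ := F.exists_coeff_of_mem_cone hwt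
  set τ : Set ι := {ρ | c ρ ≠ 0}
  have hτ : τ ∈ F.cones := F.face_mem t ht _ fun ρ hρ => by
    by_contra h
    exact hρ (hct ρ h)
  obtain ⟨p, hp, hpτ⟩ := F.exists_mem_divisorPolytope hproj hCartier hnef hτ
  have hT : ∀ r : Fin n → ℝ, r ⬝ᵥ F.coneCenter T - q ⬝ᵥ F.coneCenter T =
      ∑ ρ, (if ρ ∈ T then (1 : ℝ) else 0) * (r ⬝ᵥ F.ray ρ + a ρ) := by
    intro r
    rw [coneCenter, dotProduct_sum_smul_ray, dotProduct_sum_smul_ray, ← Finset.sum_sub_distrib]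
    refine Finset.sum_congr rfl fun ρ _ => ?_
    split_ifs with h
    · rw [hqT ρ h]; ring
    · ring
  have hτ' : ∀ r : Fin n → ℝ, r ⬝ᵥ F.coneCenter T - p ⬝ᵥ F.coneCenter T =
      ∑ ρ, c ρ * (r ⬝ᵥ F.ray ρ + a ρ) := by
    intro r
    rw [← hsum, dotProduct_sum_smul_ray, dotProduct_sum_smul_ray, ← Finset.sum_sub_distrib]
    refine Finset.sum_congr rfl fun ρ _ => ?_
    by_cases h : c ρ = 0
    · rw [h]; ring
    · rw [hpτ ρ h]; ring
  have hi0 : ∀ ρ, (0 : ℝ) ≤ if ρ ∈ T then (1 : ℝ) else 0 := fun ρ => by split_ifs <;> norm_num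
  have hpq : p ⬝ᵥ F.coneCenter T = q ⬝ᵥ F.coneCenter T := by
    have h1 : 0 ≤ p ⬝ᵥ F.coneCenter T - q ⬝ᵥ F.coneCenter T := by
      rw [hT]
      exact Finset.sum_nonneg fun ρ _ => mul_nonneg (hi0 ρ) (by linarith [hp ρ])
    have h2 : 0 ≤ q ⬝ᵥ F.coneCenter T - p ⬝ᵥ F.coneCenter T := by
      rw [hτ']
      exact Finset.sum_nonneg fun ρ _ => mul_nonneg (hc0 ρ) (by linarith [hq.1 ρ])
    linarith
  refine ⟨fun ρ => if ρ ∈ τ then 0 else if ρ ∈ T then 1 else x ρ, ?_, ?_⟩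
  · refine Eq.trans (eval_eq_of_forall_support (T := T) (τ := τ) (fun ρ => Iff.rfl) (fun ρ => ?_)
      (fun ρ h1 h2 => by simp [h1, h2]) fun d hd => ?_).symm hx
    · by_cases h2 : ρ ∈ τ
      · simp [h2]
      · by_cases h1 : ρ ∈ T
        · simp [h1, h2]
        · have hxρ : x ρ ≠ 0 := h1
          simp [h1, h2, hxρ]
    · obtain ⟨m, hm⟩ := F.exists_character_of_mem_support hf hd
      have e : ∑ ρ, (if ρ ∈ T then (1 : ℝ) else 0) * (d ρ : ℝ) = ∑ ρ, c ρ * (d ρ : ℝ) := by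
        simp only [hm]
        rw [← hT, ← hτ', hpq]
      have z1 := Finset.sum_eq_zero_iff_of_nonneg (s := Finset.univ)
        (f := fun ρ => (if ρ ∈ T then (1 : ℝ) else 0) * (d ρ : ℝ))
        fun ρ _ => mul_nonneg (hi0 ρ) (Nat.cast_nonneg _)
      have z2 := Finset.sum_eq_zero_iff_of_nonneg (s := Finset.univ)
        (f := fun ρ => c ρ * (d ρ : ℝ)) fun ρ _ => mul_nonneg (hc0 ρ) (Nat.cast_nonneg _)
      rw [e, z2] at z1
      simp only [Finset.mem_univ, true_implies, mul_eq_zero, Nat.cast_eq_zero] at z1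
      constructor
      · exact fun h ρ hρ => (z1.2 (fun κ => by
          by_cases hκ : κ ∈ T
          · exact Or.inr (h κ hκ)
          · exact Or.inl (if_neg hκ)) ρ).resolve_left hρ
      · intro h ρ hρ
        refine (z1.1 (fun κ => ?_) ρ).resolve_left (by simp [hρ])
        by_cases hκ : c κ = 0
        · exact Or.inl hκ
        · exact Or.inr (h κ hκ)
  · convert hτ using 1
    ext ρ
    by_cases h2 : ρ ∈ τ
    · simp [h2]
    · by_cases h1 : ρ ∈ T
      · simp [h1, h2]
      · have hxρ : x ρ ≠ 0 := h1
        simp [h1, h2, hxρ]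

theorem exists_divisorFan_of_mem_cones (hproj : F.IsProjective) {a : ι → ℤ}
    (hCartier : F.IsCartier a) (hnef : F.IsNef a) {s : Set ι} (hs : s ∈ F.cones) :
    ∃ σ ∈ F.divisorFan a, ∀ ρ ∈ s, F.ray ρ ∈ σ := by
  classical
  obtain ⟨p, hp, hps⟩ := F.exists_mem_divisorPolytope hproj hCartier hnef hs
  have hle : ∀ r ∈ F.divisorPolytope a, ∀ ρ, (if ρ ∈ s then (1 : ℝ) else 0) * (p ⬝ᵥ F.ray ρ) ≤
      (if ρ ∈ s then (1 : ℝ) else 0) * (r ⬝ᵥ F.ray ρ) := by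
    intro r hr ρ
    split_ifs with h
    · rw [hps ρ h, one_mul, one_mul]; exact hr ρ
    · simp
  have hpface : p ∈ polytopeFace (F.divisorPolytope a) (F.coneCenter s) := by
    refine ⟨hp, fun r hr => ?_⟩
    rw [coneCenter, dotProduct_sum_smul_ray, dotProduct_sum_smul_ray]
    exact Finset.sum_le_sum fun ρ _ => hle r hr ρ
  refine ⟨_, ⟨F.coneCenter s, ⟨p, hpface⟩, rfl⟩, fun ρ hρ q hq r hr => ?_⟩
  have heq := le_antisymm (hpface.2 q hq.1) (hq.2 p hp)
  rw [coneCenter, dotProduct_sum_smul_ray, dotProduct_sum_smul_ray] at heq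
  have := (Finset.sum_eq_sum_iff_of_le fun κ _ => hle q hq.1 κ).1 heq ρ (Finset.mem_univ ρ)
  simp only [if_pos hρ, one_mul] at this
  rw [← this, hps ρ hρ]
  exact hr ρ

/-! ### Rational points -/

theorem notMem_exceptionalSet {L : Type*} [Field L] {x : ι → L} (hx : {ρ | x ρ = 0} ∈ F.cones) :
    x ∉ F.exceptionalSet L := by
  classical
  intro h
  have h0 := h _ hx
  rw [Finset.prod_eq_zero_iff] at h0
  obtain ⟨ρ, hρ, h1⟩ := h0
  simp [h1] at hρ

theorem baseChange_coxMap {K L : Type*} [Field K] [Field L] [Algebra K L] {x : ι → K}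
    (hx : x ∉ F.exceptionalSet K) (hx' : (fun ρ => algebraMap K L (x ρ)) ∉ F.exceptionalSet L) :
    (F.coxMap x hx).baseChange L = F.coxMap (fun ρ => algebraMap K L (x ρ)) hx' := by
  refine Quot.sound ⟨fun ρ hρ => ?_, ?_⟩
  · change algebraMap K L (x ρ) = 0
    rw [show x ρ = 0 from hρ, map_zero]
  · refine MonoidHom.ext fun m => ?_
    change ∏ ρ, algebraMap K L (x ρ) ^ _ = algebraMap K L (∏ ρ, x ρ ^ _)
    rw [map_prod]
    refine Finset.prod_congr rfl fun ρ _ => ?_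
    rw [map_zpow₀]
    rfl

theorem rationalPoints_nonempty {K : Type*} [Field K] {f : MvPolynomial ι K} {x : ι → K}
    (hf : MvPolynomial.eval x f = 0) (hx : {ρ | x ρ = 0} ∈ F.cones) :
    (F.rationalPoints f).Nonempty := by
  have hx' : {ρ | algebraMap K (AlgebraicClosure K) (x ρ) = 0} ∈ F.cones := by
    simpa using hx
  refine ⟨F.coxMap x (F.notMem_exceptionalSet hx), _, F.notMem_exceptionalSet hx', ?_,
    (F.baseChange_coxMap _ _).symm⟩
  have := MvPolynomial.aeval_algebraMap_apply (AlgebraicClosure K) x f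
  change MvPolynomial.aeval (algebraMap K (AlgebraicClosure K) ∘ x) f = 0
  simpa [MvPolynomial.coe_aeval_eq_eval, hf, Function.comp_def] using this

end SimplicialFan

theorem proposition4p4 {K : Type*} [Field K] (hC1 : IsC1Field K) (hH1 : AdmitsNormicForms K)
    {n : ℕ} {ι : Type*} [Fintype ι] (F : SimplicialFan n ι) (hproj : F.IsProjective)
    (hH3 : F.TorsionPrimeToChar K)
    (a : ι → ℤ) (hCartier : F.IsCartier a) (hnef : F.IsNef a)
    (f : MvPolynomial ι K) (hf0 : f ≠ 0) (hf : f ∈ F.coxPiece K (F.divisorClass a)) :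
    ((∃ α : ι → K, MvPolynomial.eval α f = 0 ∧
        ∃ σ ∈ F.divisorFan a, ∀ ρ, α ρ = 0 → F.ray ρ ∈ σ) ↔
      (∃ α : ι → K, MvPolynomial.eval α f = 0 ∧
        ∃ s ∈ F.cones, ∀ ρ, α ρ = 0 → F.ray ρ ∈ F.cone s)) ∧
    ((∃ α : ι → K, MvPolynomial.eval α f = 0 ∧
        ∃ σ ∈ F.divisorFan a, ∀ ρ, α ρ = 0 → F.ray ρ ∈ σ) →
      (F.rationalPoints f).Nonempty) := by
  refine ⟨⟨?_, ?_⟩, ?_⟩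
  · rintro ⟨α, hα, σ, hσ, hασ⟩
    obtain ⟨β, hβ, hβs⟩ := F.exists_root_zeroSet_mem_cones hproj hCartier hnef hf hα hσ hασ
    exact ⟨β, hβ, _, hβs, fun ρ hρ => F.ray_mem_cone hρ⟩
  · rintro ⟨α, hα, s, hs, hαs⟩
    obtain ⟨σ, hσ, hsσ⟩ := F.exists_divisorFan_of_mem_cones hproj hCartier hnef hs
    exact ⟨α, hα, σ, hσ, fun ρ hρ => hsσ ρ (F.mem_of_ray_mem_cone hs (hαs ρ hρ))⟩
  · rintro ⟨α, hα, σ, hσ, hασ⟩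
    obtain ⟨β, hβ, hβs⟩ := F.exists_root_zeroSet_mem_cones hproj hCartier hnef hf hα hσ hασ
    exact F.rationalPoints_nonempty hβ hβs
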